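/- Let $X$ be a compact (Hausdorff) complex manifold of dimension $m$ and let $f_n:\mathbb D\to X$, $n\in\mathbb N$, be holomorphic maps from the open unit disc $\mathbb D\subset\mathbb C$. Say that $(f_n)_n$ is normal at $0$ if there is an open neighbourhood $U\subset\mathbb D$ of $0$ such that every subsequence of $(f_n)_n$ has a further subsequence converging locally uniformly on $U$ (with respect to the uniform structure of $X$, i.e. to any distance defining its topology). If $(f_n)_n$ is not normal at $0$, then there are affine contractions $r_n(z)=t_n+\epsilon_n z$ of $\mathbb C$ with $\epsilon_n\neq0$, $|t_n|+|\epsilon_n|<1$ for every $n$, $t_n\to0$ and $\epsilon_n\to0$, such that a subsequence of $(f_n\circ r_n)_n$ (each compact subset of $\mathbb C$ lies in the domain of $f_n\circ r_n$ for all large $n$) converges locally uniformly on $\mathbb C$ to a nonconstant holomorphic map $g:\mathbb C\to X$; moreover $g$ is uniformly continuous for the Euclidean distance on $\mathbb C$ and any distance defining the topology of $X$. -/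

import Mathlib

open Filter Topology
open scoped Manifold ContDiff

/-- The sequence `f` is normal on `U`: every subsequence of `f` has a further subsequence which
converges locally uniformly on `U`. (Meant for compact `X`, where there is no need to allow
divergence to infinity.) -/
def SeqNormalOn {X : Type*} [UniformSpace X] (f : ℕ → ℂ → X) (U : Set ℂ) : Prop :=
  ∀ φ : ℕ → ℕ, StrictMono φ → ∃ ψ : ℕ → ℕ, StrictMono ψ ∧
    ∃ g : ℂ → X, TendstoLocallyUniformlyOn (fun n => f (φ (ψ n))) g atTop U

/-- The sequence `f` of maps on `D` is normal at the point `z`: it is normal on some open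
neighbourhood of `z` contained in `D`. -/
def SeqNormalAt {X : Type*} [UniformSpace X] (f : ℕ → ℂ → X) (D : Set ℂ) (z : ℂ) : Prop :=
  ∃ U : Set ℂ, IsOpen U ∧ z ∈ U ∧ U ⊆ D ∧ SeqNormalOn f U

/-! This is Zalcman-Brody rescaling without a metric on `X`: the derivative is replaced by
`coverRadius`, the radius of the largest disc that `f` maps into one member of a cover by small
chart domains. By the Schwarz lemma in charts, a lower bound on this radius gives equicontinuity
(`exists_finite_cover_forall_mapsTo_ball`), so by Arzelà-Ascoli failure of normality makes the
radius arbitrarily small near `0`. Point selection (`exists_forall_le_two_mul`) yields centers whose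
radius `ε` is at most twice the radius at all points of a disc much larger than `ε`. Rescaling by
`ε` gives equicontinuity with constants independent of the point, hence a uniformly continuous limit
on `ℂ`. It is not constant, since otherwise a disc of radius `2 * ε` would land in one cover member.
-/

open Set Metric Uniformity

/-! ### Arzelà-Ascoli -/

/-- A form of the Arzelà-Ascoli theorem for sequences which are only eventually equicontinuous. -/
theorem exists_subseq_tendstoLocallyUniformlyOn {α X : Type*} [TopologicalSpace α]
    [TopologicalSpace.SeparableSpace α] [UniformSpace X] [CompactSpace X]
    [IsCountablyGenerated (𝓤 X)] {U : Set α} (f : ℕ → α → X)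
    (h : ∀ z ∈ U, ∀ V ∈ 𝓤 X, ∃ W ∈ 𝓝 z, ∀ᶠ n in atTop, ∀ w ∈ W, (f n z, f n w) ∈ V) :
    ∃ ψ : ℕ → ℕ, StrictMono ψ ∧
      ∃ g : α → X, TendstoLocallyUniformlyOn (fun n => f (ψ n)) g atTop U := by
  obtain ⟨D, hDc, hD⟩ := TopologicalSpace.exists_countable_dense α
  have : Countable D := hDc.to_subtype
  obtain ⟨a, ψ, hψ, ha⟩ := CompactSpace.tendsto_subseq (fun n (d : D) => f n d)
  rw [tendsto_pi_nhds] at ha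
  have key : ∀ z ∈ U, ∀ V ∈ 𝓤 X, ∃ W ∈ 𝓝 z, ∃ N, ∀ m ≥ N, ∀ n ≥ N, ∀ w ∈ W,
      (f (ψ m) w, f (ψ n) w) ∈ V := by
    intro z hz V hV
    obtain ⟨V₁, hV₁, hs₁, hVV₁⟩ := comp_symm_mem_uniformity_sets hV
    -- Successive halvings serve the chain `f (ψ m) w`, `f (ψ m) d`, `f (ψ n) d`, `f (ψ n) w`, whose
    -- outer links pass through the values at `z`.
    obtain ⟨V₂, hV₂, hs₂, hVV₂⟩ := comp_symm_mem_uniformity_sets hV₁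
    obtain ⟨V₃, hV₃, hs₃, hVV₃⟩ := comp_symm_mem_uniformity_sets hV₂
    obtain ⟨W, hW, hfW⟩ := h z hz V₃ hV₃
    obtain ⟨d, hdW, hdD⟩ := hD.inter_open_nonempty (interior W) isOpen_interior
      ⟨z, mem_interior_iff_mem_nhds.2 hW⟩
    have hcau := (ha ⟨d, hdD⟩).cauchySeq
    rw [_root_.cauchySeq_iff] at hcau
    obtain ⟨N₁, hN₁⟩ := hcau V₂ hV₂
    obtain ⟨N₂, hN₂⟩ := eventually_atTop.1 (hψ.tendsto_atTop.eventually hfW)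
    refine ⟨W, hW, max N₁ N₂, fun m hm n hn w hw => ?_⟩
    have hw' : ∀ n ≥ max N₁ N₂, (f (ψ n) w, f (ψ n) d) ∈ V₂ := fun n hn =>
      hVV₃ ⟨f (ψ n) z, hs₃.symm _ _ (hN₂ n (le_of_max_le_right hn) w hw),
        hN₂ n (le_of_max_le_right hn) d (interior_subset hdW)⟩
    have hd := hN₁ m (le_of_max_le_left hm) n (le_of_max_le_left hn)
    have hV₂V₁ : V₂ ⊆ V₁ := fun p hp => hVV₂ ⟨p.2, hp, refl_mem_uniformity hV₂⟩
    exact hVV₁ ⟨f (ψ n) d, hVV₂ ⟨f (ψ m) d, hw' m hm, hd⟩,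
      hV₂V₁ (hs₂.symm _ _ (hw' n hn))⟩
  have hlim : ∀ z, ∃ x, z ∈ U → Tendsto (fun n => f (ψ n) z) atTop (𝓝 x) := by
    intro z
    by_cases hz : z ∈ U
    · have : CauchySeq fun n => f (ψ n) z := by
        rw [_root_.cauchySeq_iff]
        intro V hV
        obtain ⟨W, hW, N, hN⟩ := key z hz V hV
        exact ⟨N, fun m hm n hn => hN m hm n hn z (mem_of_mem_nhds hW)⟩
      obtain ⟨x, hx⟩ := cauchySeq_tendsto_of_complete this
      exact ⟨x, fun _ => hx⟩
    · exact ⟨f 0 z, fun h => (hz h).elim⟩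
  choose g hg using hlim
  refine ⟨ψ, hψ, g, fun V hV z hz => ?_⟩
  obtain ⟨V', ⟨hV', hcl⟩, hVV'⟩ := uniformity_hasBasis_closed.mem_iff.1 hV
  obtain ⟨W, hW, N, hN⟩ := key z hz V' hV'
  refine ⟨U ∩ W, inter_mem_nhdsWithin U hW, ?_⟩
  filter_upwards [eventually_ge_atTop N] with n hn w hw
  refine hVV' (hcl.mem_of_tendsto ((hg w hw.1).prodMk_nhds tendsto_const_nhds) ?_)
  filter_upwards [eventually_ge_atTop N] with m hm using hN m hm n hn w hw.2

/-! ### Schwarz estimate in charts and holomorphy of limits -/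

section Manifold

variable {E X : Type*} [NormedAddCommGroup E] [NormedSpace ℂ E] [UniformSpace X]
  [ChartedSpace E X] [IsManifold 𝓘(ℂ, E) ω X]

/-- A compact complex manifold has a finite open cover such that holomorphic maps from discs into
members of the cover satisfy a uniform, scale invariant equicontinuity estimate. -/
theorem exists_finite_cover_forall_mapsTo_ball [CompactSpace X] [T2Space X] :
    ∃ 𝒰 : Set (Set X), 𝒰.Finite ∧ (∀ A ∈ 𝒰, IsOpen A) ∧ (∀ x, ∃ A ∈ 𝒰, x ∈ A) ∧
      ∀ V ∈ 𝓤 X, ∃ δ > 0, ∀ A ∈ 𝒰, ∀ (h : ℂ → X) (z : ℂ) (r : ℝ), 0 < r →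
        MDifferentiableOn 𝓘(ℂ) 𝓘(ℂ, E) h (ball z r) → MapsTo h (ball z r) A →
        ∀ w ∈ ball z (δ * r), (h z, h w) ∈ V := by
  have hK : ∀ x : X, ∃ K ∈ 𝓝 x, K ⊆ (chartAt E x).source ∧ IsCompact K := fun x =>
    local_compact_nhds ((chartAt E x).open_source.mem_nhds (mem_chart_source E x))
  choose K hKn hKs hKc using hK
  obtain ⟨s, -, hs⟩ := isCompact_univ.elim_nhds_subcover (fun x => interior (K x))
    fun x _ => interior_mem_nhds.2 (hKn x)
  refine ⟨(fun x => interior (K x)) '' s, s.finite_toSet.image _, ?_, ?_, ?_⟩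
  · rintro _ ⟨x, -, rfl⟩
    exact isOpen_interior
  · intro x
    obtain ⟨y, hy, hxy⟩ := mem_iUnion₂.1 (hs (mem_univ x))
    exact ⟨_, ⟨y, hy, rfl⟩, hxy⟩
  intro V hV
  have hx : ∀ x : X, ∃ δ > 0, ∀ (h : ℂ → X) (z : ℂ) (r : ℝ), 0 < r →
      MDifferentiableOn 𝓘(ℂ) 𝓘(ℂ, E) h (ball z r) → MapsTo h (ball z r) (interior (K x)) →
      ∀ w ∈ ball z (δ * r), (h z, h w) ∈ V := by
    intro x
    set e := chartAt E x
    have hc : IsCompact (e '' K x) := (hKc x).image_of_continuousOn (e.continuousOn.mono (hKs x))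
    have huc := hc.uniformContinuousOn_of_continuous (f := e.symm)
      (e.continuousOn_symm.mono (by
        rintro _ ⟨y, hy, rfl⟩
        exact e.map_source (hKs x hy)))
    obtain ⟨η, hη, hηV⟩ := (Metric.uniformity_basis_dist.inf_principal _).mem_iff.1 (huc hV)
    obtain ⟨M, hM⟩ := Metric.isBounded_iff.1 hc.isBounded
    -- `M` bounds distances in the chart image of `K x`, so Schwarz gives the Lipschitz constant
    -- `(|M| + 1) / r`. The bound `1` keeps `w` in the disc.
    refine ⟨min 1 (η / (|M| + 1)), by positivity, fun h z r hr hh hm w hw => ?_⟩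
    have hM1 : 0 < |M| + 1 := by positivity
    have hmK : MapsTo h (ball z r) (K x) := hm.mono_right interior_subset
    have hzr : z ∈ ball z r := mem_ball_self hr
    have hwr : w ∈ ball z r := ball_subset_ball (by nlinarith [min_le_left 1 (η / (|M| + 1))]) hw
    have hd : DifferentiableOn ℂ (e ∘ h) (ball z r) := by
      rw [← mdifferentiableOn_iff_differentiableOn]
      exact ((contMDiffOn_chart (I := 𝓘(ℂ, E)) (n := ω)).mdifferentiableOn (by simp)).comp hh
        (hmK.mono_right (hKs x))
    have hS := Complex.dist_le_div_mul_dist_of_mapsTo_ball (R₂ := |M| + 1) hd (fun y hy =>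
      ((hM ⟨_, hmK hy, rfl⟩ ⟨_, hmK hzr, rfl⟩).trans ((le_abs_self M).trans (by simp)))) hwr
    have hlt : dist (e (h z)) (e (h w)) < η := by
      rw [dist_comm]
      refine hS.trans_lt ?_
      rw [mem_ball] at hw
      calc (|M| + 1) / r * dist w z < (|M| + 1) / r * (η / (|M| + 1) * r) := by
            gcongr
            exact hw.trans_le (by gcongr; exact min_le_right _ _)
        _ = η := by field_simp
    have : (e.symm (e (h z)), e.symm (e (h w))) ∈ V :=
      hηV (a := (e (h z), e (h w))) ⟨hlt, ⟨_, hmK hzr, rfl⟩, ⟨_, hmK hwr, rfl⟩⟩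
    rwa [e.left_inv (hKs x (hmK hzr)), e.left_inv (hKs x (hmK hwr))] at this
  choose δ hδ hδV using hx
  obtain ⟨d, hd, hds⟩ : ∃ d > 0, ∀ x ∈ s, d ≤ δ x := by
    rcases s.eq_empty_or_nonempty with rfl | hne
    · exact ⟨1, one_pos, by simp⟩
    · exact ⟨s.inf' hne δ, by simpa using fun x _ => hδ x, fun x hx => Finset.inf'_le _ hx⟩
  refine ⟨d, hd, ?_⟩
  rintro _ ⟨x, hx, rfl⟩ h z r hr hh hm w hw
  exact hδV x h z r hr hh hm w (ball_subset_ball (by gcongr; exact hds x hx) hw)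

/-- A locally uniform limit of maps which are eventually holomorphic near every point is
holomorphic. -/
theorem mdifferentiable_of_tendstoLocallyUniformly [CompleteSpace E] [LocallyCompactSpace X]
    {F : ℕ → ℂ → X} {g : ℂ → X} (hF : TendstoLocallyUniformly F g atTop)
    (hd : ∀ R : ℝ, ∀ᶠ n in atTop, MDifferentiableOn 𝓘(ℂ) 𝓘(ℂ, E) (F n) (ball 0 R)) :
    MDifferentiable 𝓘(ℂ) 𝓘(ℂ, E) g := by
  have : IsManifold 𝓘(ℂ, E) 1 X := .of_le (n := ω) (by simp)
  intro z
  obtain ⟨R, hR⟩ : ∃ R, ball z 1 ⊆ ball (0 : ℂ) R := ⟨1 + dist z 0, ball_subset_ball' le_rfl⟩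
  have hg : Continuous g := by
    rw [continuous_iff_continuousAt]
    intro w
    obtain ⟨R', hR'⟩ : ∃ R', w ∈ ball (0 : ℂ) R' := ⟨dist w 0 + 1, by simp⟩
    refine ((hF.tendstoLocallyUniformlyOn (s := ball 0 R')).continuousOn
      ?_).continuousAt (isOpen_ball.mem_nhds hR')
    exact (hd R').frequently.mono fun n hn => hn.continuousOn
  set e := chartAt E (g z)
  obtain ⟨K, hKn, hKs, hKc⟩ := local_compact_nhds
    (e.open_source.mem_nhds (mem_chart_source E (g z)))
  obtain ⟨V, hV, hVK⟩ := UniformSpace.mem_nhds_iff.1 hKn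
  obtain ⟨V', hV', hs', hVV'⟩ := comp_symm_mem_uniformity_sets hV
  obtain ⟨W, hW, hWV⟩ := hF V' hV' z
  have hgW : g ⁻¹' (UniformSpace.ball (g z) V') ∈ 𝓝 z :=
    hg.continuousAt.preimage_mem_nhds (UniformSpace.ball_mem_nhds _ hV')
  obtain ⟨r, hr, hrW⟩ := Metric.mem_nhds_iff.1
    (inter_mem (inter_mem hW hgW) (ball_mem_nhds z one_pos))
  have hgK : MapsTo g (ball z r) K := fun w hw =>
    hVK (hVV' ⟨g w, (hrW hw).1.2, refl_mem_uniformity hV'⟩)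
  have hFK : ∀ᶠ n in atTop, MapsTo (F n) (ball z r) K := by
    filter_upwards [hWV] with n hn w hw
    exact hVK (hVV' ⟨g w, (hrW hw).1.2, hn w (hrW hw).1.1⟩)
  have hu : UniformContinuousOn e K :=
    hKc.uniformContinuousOn_of_continuous (e.continuousOn.mono hKs)
  -- Uniform continuity of the chart on `K` carries the convergence to `E`, where Weierstrass'
  -- theorem applies.
  have hlim := hu.comp_tendstoLocallyUniformlyOn (hF.tendstoLocallyUniformlyOn (s := ball z r))
    hgK hFK
  have hdiff : DifferentiableOn ℂ (e ∘ g) (ball z r) := by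
    refine hlim.differentiableOn ?_ isOpen_ball
    filter_upwards [hd R, hFK] with n hn hnK
    rw [← mdifferentiableOn_iff_differentiableOn]
    exact ((contMDiffOn_chart (I := 𝓘(ℂ, E)) (n := ω)).mdifferentiableOn (by simp)).comp
      (hn.mono fun w hw => hR (hrW hw).2) (hnK.mono_right hKs)
  have h1 : MDifferentiableAt 𝓘(ℂ) 𝓘(ℂ, E) (e.symm ∘ (e ∘ g)) z := by
    refine MDifferentiableAt.comp z (mdifferentiableAt_atlas_symm (chart_mem_atlas E (g z))
      (e.map_source (mem_chart_source E (g z)))) ?_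
    exact (hdiff.differentiableAt (ball_mem_nhds z hr)).mdifferentiableAt
  refine h1.congr_of_eventuallyEq ?_
  filter_upwards [ball_mem_nhds z hr] with w hw
  exact (e.left_inv (hKs (hgK hw))).symm

end Manifold

/-! ### The cover radius -/

/-- The radius of the largest disc around `z` within the unit disc which `f` maps into a single
member of `𝒰`. -/
noncomputable def coverRadius {X : Type*} (𝒰 : Set (Set X)) (f : ℂ → X) (z : ℂ) : ℝ :=
  sSup {r | r ≤ 1 - ‖z‖ ∧ ∃ A ∈ 𝒰, MapsTo f (ball z r) A}

section coverRadius

variable {X : Type*} {𝒰 : Set (Set X)} {f : ℂ → X} {z w : ℂ} {r : ℝ}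

theorem le_coverRadius {A : Set X} (hr : r ≤ 1 - ‖z‖) (hA : A ∈ 𝒰) (h : MapsTo f (ball z r) A) :
    r ≤ coverRadius 𝒰 f z :=
  le_csSup ⟨1 - ‖z‖, fun _ h => h.1⟩ ⟨hr, A, hA, h⟩

theorem coverRadius_set_nonempty (h𝒰 : 𝒰.Nonempty) :
    {r | r ≤ 1 - ‖z‖ ∧ ∃ A ∈ 𝒰, MapsTo f (ball z r) A}.Nonempty := by
  obtain ⟨A, hA⟩ := h𝒰
  refine ⟨min 0 (1 - ‖z‖), min_le_right _ _, A, hA, ?_⟩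
  rw [ball_eq_empty.2 (min_le_left _ _)]
  exact mapsTo_empty _ _

theorem exists_mapsTo_of_lt_coverRadius (h𝒰 : 𝒰.Nonempty) (hr : r < coverRadius 𝒰 f z) :
    r ≤ 1 - ‖z‖ ∧ ∃ A ∈ 𝒰, MapsTo f (ball z r) A := by
  obtain ⟨s, ⟨hs, A, hA, h⟩, hrs⟩ := exists_lt_of_lt_csSup (coverRadius_set_nonempty h𝒰) hr
  exact ⟨hrs.le.trans hs, A, hA, h.mono_left (ball_subset_ball hrs.le)⟩

/-- The disc around `w` of radius `r - dist z w` lies in the disc around `z` of radius `r`, and the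
cap `1 - ‖z‖` is itself 1-Lipschitz. -/
theorem coverRadius_le_add_dist (h𝒰 : 𝒰.Nonempty) (z w : ℂ) :
    coverRadius 𝒰 f z ≤ coverRadius 𝒰 f w + dist z w := by
  refine csSup_le (coverRadius_set_nonempty h𝒰) ?_
  rintro r ⟨hr, A, hA, h⟩
  rw [← sub_le_iff_le_add]
  refine le_coverRadius ?_ hA (h.mono_left (ball_subset_ball' ?_))
  · have := norm_le_norm_add_norm_sub' w z
    rw [dist_eq_norm']
    linarith
  · rw [dist_comm w z]
    linarith

theorem continuous_coverRadius (h𝒰 : 𝒰.Nonempty) : Continuous (coverRadius 𝒰 f) :=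
  (LipschitzWith.of_le_add fun z w => coverRadius_le_add_dist h𝒰 z w).continuous

theorem coverRadius_pos [TopologicalSpace X] (hop : ∀ A ∈ 𝒰, IsOpen A)
    (hcov : ∀ x, ∃ A ∈ 𝒰, x ∈ A) (hf : ContinuousOn f (ball 0 1)) (hz : ‖z‖ < 1) :
    0 < coverRadius 𝒰 f z := by
  obtain ⟨A, hA, hzA⟩ := hcov (f z)
  have hfz := hf.continuousAt (isOpen_ball.mem_nhds (mem_ball_zero_iff.2 hz))
  obtain ⟨r, hr, hrA⟩ := Metric.mem_nhds_iff.1 (hfz.preimage_mem_nhds ((hop A hA).mem_nhds hzA))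
  have : 0 < min r (1 - ‖z‖) := lt_min hr (by linarith)
  exact this.trans_le (le_coverRadius (min_le_right _ _) hA
    fun w hw => hrA (ball_subset_ball (min_le_left _ _) hw))

end coverRadius

/-! ### Point selection and auxiliary facts -/

/-- A point where a positive function `R` is small can be moved to a nearby point `t` such that
`R` is at least `R t / 2` on a ball around `t` which is large compared with `R t`. -/
theorem exists_forall_le_two_mul {E : Type*} [NormedAddCommGroup E] [ProperSpace E] {R : E → ℝ}
    {ρ k : ℝ} {z : E} (hR : ContinuousOn R (closedBall 0 ρ)) (hpos : ∀ w, ‖w‖ ≤ ρ → 0 < R w)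
    (hk : 0 < k) (hz : ‖z‖ < ρ / 2) (hzR : k * R z ≤ ρ / 2) :
    ∃ t, ‖t‖ < ρ ∧ k * R t ≤ ρ ∧ ∀ w, 2 * dist w t ≤ k * R t → R t ≤ 2 * R w := by
  have hρ : 0 < ρ := by linarith [norm_nonneg z]
  -- The weight `ρ - ‖w‖` vanishes on the boundary, keeping the maximizer `t` inside. The quotient
  -- is at least `k` at `z`, hence at `t`; within `k * R t / 2` of `t` the weight drops at most by
  -- half.
  obtain ⟨t, ht, hmax⟩ := (isCompact_closedBall (0 : E) ρ).exists_isMaxOn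
    (nonempty_closedBall.2 hρ.le) (f := fun w => (ρ - ‖w‖) / R w)
    ((by fun_prop : ContinuousOn (fun w : E => ρ - ‖w‖) _).div hR
      fun w hw => (hpos w (mem_closedBall_zero_iff.1 hw)).ne')
  rw [mem_closedBall_zero_iff] at ht
  have hmax : ∀ w, ‖w‖ ≤ ρ → (ρ - ‖w‖) / R w ≤ (ρ - ‖t‖) / R t := fun w hw =>
    hmax (mem_closedBall_zero_iff.2 hw)
  have htR := hpos t ht
  have hzρ : ‖z‖ ≤ ρ := by linarith
  have hkt : k * R t ≤ ρ - ‖t‖ := by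
    rw [← le_div_iff₀ htR]
    refine le_trans ?_ (hmax z hzρ)
    rw [le_div_iff₀ (hpos z hzρ)]
    linarith
  have hkR : 0 < k * R t := by positivity
  refine ⟨t, by linarith, by linarith [norm_nonneg t], fun w hw => ?_⟩
  have h1 : ‖w‖ ≤ ‖t‖ + dist w t := by
    rw [dist_eq_norm]
    exact norm_le_norm_add_norm_sub' w t
  have hwρ : ‖w‖ ≤ ρ := by linarith
  have h2 := hmax w hwρ
  rw [div_le_div_iff₀ (hpos w hwρ) htR] at h2
  nlinarith [hpos w hwρ]

/-- Extends centers and scales, built only along a subsequence, to all indices. -/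
theorem tendsto_extend_atTop {α : Type*} {φ : ℕ → ℕ} (hφ : StrictMono φ) {a b : ℕ → α}
    {l : Filter α} (ha : Tendsto a atTop l) (hb : Tendsto b atTop l) :
    Tendsto (Function.extend φ a b) atTop l := by
  intro s hs
  obtain ⟨N, hN⟩ := eventually_atTop.1 (ha hs)
  have h := hb hs
  rw [mem_map] at h ⊢
  filter_upwards [h, eventually_ge_atTop (φ N)] with n hn hnN
  by_cases hx : ∃ k, φ k = n
  · obtain ⟨k, rfl⟩ := hx
    rw [mem_preimage, hφ.injective.extend_apply]
    exact hN k (hφ.le_iff_le.1 hnN)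
  · rwa [mem_preimage, Function.extend_apply' _ _ _ hx]

/-- The uniformity of a compact manifold modelled on a second countable space is countably
generated. -/
theorem ChartedSpace.isCountablyGenerated_uniformity (H : Type*) {X : Type*} [TopologicalSpace H]
    [SecondCountableTopology H] [UniformSpace X] [CompactSpace X] [T2Space X] [ChartedSpace H X] :
    IsCountablyGenerated (𝓤 X) := by
  have := ChartedSpace.secondCountable_of_sigmaCompact H X
  have := TopologicalSpace.metrizableSpace_of_t3_secondCountable X
  let M := TopologicalSpace.metrizableSpaceMetric X
  have h : ‹UniformSpace X› = M.toUniformSpace := unique_uniformity_of_compact rfl rfl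
  rw [h]
  exact EMetric.instIsCountablyGeneratedUniformity

/-! ### Rescaling -/

section Manifold

variable {E X : Type*} [NormedAddCommGroup E] [NormedSpace ℂ E] [UniformSpace X]
  [ChartedSpace E X] {𝒰 : Set (Set X)}

theorem mem_entourage_of_lt_coverRadius {V : Set (X × X)} {δ : ℝ} (h𝒰 : 𝒰.Nonempty)
    (hδ : ∀ A ∈ 𝒰, ∀ (h : ℂ → X) (z : ℂ) (r : ℝ), 0 < r →
      MDifferentiableOn 𝓘(ℂ) 𝓘(ℂ, E) h (ball z r) → MapsTo h (ball z r) A →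
      ∀ w ∈ ball z (δ * r), (h z, h w) ∈ V)
    {f : ℂ → X} (hf : MDifferentiableOn 𝓘(ℂ) 𝓘(ℂ, E) f (ball 0 1)) {z w : ℂ} {r : ℝ} (hr : 0 < r)
    (hrz : r < coverRadius 𝒰 f z) (hw : dist w z < δ * r) : (f z, f w) ∈ V := by
  obtain ⟨hr1, A, hA, h⟩ := exists_mapsTo_of_lt_coverRadius h𝒰 hrz
  refine hδ A hA f z r hr (hf.mono (ball_subset_ball' ?_)) h w hw
  rw [dist_zero_right]
  linarith

/-- If a sequence of holomorphic maps is not normal at `0`, then the radii of the discs with small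
image are not bounded below near `0`. -/
theorem frequently_exists_coverRadius_lt [CompactSpace X] [IsCountablyGenerated (𝓤 X)]
    (h𝒰 : 𝒰.Nonempty)
    (heq : ∀ V ∈ 𝓤 X, ∃ δ > 0, ∀ A ∈ 𝒰, ∀ (h : ℂ → X) (z : ℂ) (r : ℝ), 0 < r →
      MDifferentiableOn 𝓘(ℂ) 𝓘(ℂ, E) h (ball z r) → MapsTo h (ball z r) A →
      ∀ w ∈ ball z (δ * r), (h z, h w) ∈ V)
    {f : ℕ → ℂ → X} (hf : ∀ n, MDifferentiableOn 𝓘(ℂ) 𝓘(ℂ, E) (f n) (ball 0 1))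
    (hnn : ¬ SeqNormalAt f (ball 0 1) 0) {ρ r : ℝ} (hρ : 0 < ρ) (hρ1 : ρ ≤ 1) (hr : 0 < r) :
    ∃ᶠ n in atTop, ∃ z, ‖z‖ < ρ ∧ coverRadius 𝒰 (f n) z < r := by
  by_contra hcon
  rw [not_frequently] at hcon
  push Not at hcon
  refine hnn ⟨ball 0 ρ, isOpen_ball, mem_ball_self hρ, ball_subset_ball hρ1, fun φ hφ => ?_⟩
  refine exists_subseq_tendstoLocallyUniformlyOn (fun n => f (φ n)) fun z hz V hV => ?_
  obtain ⟨δ, hδ, hδV⟩ := heq V hV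
  refine ⟨ball z (δ * (r / 2)), ball_mem_nhds z (by positivity), ?_⟩
  filter_upwards [hφ.tendsto_atTop.eventually hcon] with n hn w hw
  exact mem_entourage_of_lt_coverRadius h𝒰 hδV (hf _) (half_pos hr)
    ((half_lt_self hr).trans_le (hn z (mem_ball_zero_iff.1 hz))) hw

/-- The selection of centers `t` and scales `ε` for the rescaling of a sequence of holomorphic
maps which is not normal at `0`. -/
theorem exists_rescaling [CompactSpace X] [IsCountablyGenerated (𝓤 X)]
    (hop : ∀ A ∈ 𝒰, IsOpen A) (hcov : ∀ x, ∃ A ∈ 𝒰, x ∈ A)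
    (heq : ∀ V ∈ 𝓤 X, ∃ δ > 0, ∀ A ∈ 𝒰, ∀ (h : ℂ → X) (z : ℂ) (r : ℝ), 0 < r →
      MDifferentiableOn 𝓘(ℂ) 𝓘(ℂ, E) h (ball z r) → MapsTo h (ball z r) A →
      ∀ w ∈ ball z (δ * r), (h z, h w) ∈ V)
    {f : ℕ → ℂ → X} (hf : ∀ n, MDifferentiableOn 𝓘(ℂ) 𝓘(ℂ, E) (f n) (ball 0 1))
    (hnn : ¬ SeqNormalAt f (ball 0 1) 0) :
    ∃ φ : ℕ → ℕ, StrictMono φ ∧ ∃ (t : ℕ → ℂ) (ε : ℕ → ℝ), (∀ k, 0 < ε k) ∧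
      (∀ k, ‖t k‖ + ε k < 1) ∧ Tendsto t atTop (𝓝 0) ∧ Tendsto ε atTop (𝓝 0) ∧
      (∀ k, coverRadius 𝒰 (f (φ k)) (t k) = ε k) ∧
      ∀ (k : ℕ) (z : ℂ), 2 * ‖z‖ ≤ k →
        ε k ≤ 2 * coverRadius 𝒰 (f (φ k)) (t k + ε k * z) := by
  have h𝒰 : 𝒰.Nonempty := (hcov (f 0 0)).imp fun A hA => hA.1
  have hsel : ∀ k : ℕ, ∃ᶠ n in atTop, ∃ t : ℂ, ‖t‖ < 2 * (1 / ((k : ℝ) + 3)) ∧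
      0 < coverRadius 𝒰 (f n) t ∧ (k + 3) * coverRadius 𝒰 (f n) t ≤ 2 * (1 / ((k : ℝ) + 3)) ∧
      ∀ w, 2 * dist w t ≤ (k + 3) * coverRadius 𝒰 (f n) t →
        coverRadius 𝒰 (f n) t ≤ 2 * coverRadius 𝒰 (f n) w := by
    intro k
    -- Point selection is used with `ρ = 2 / (k + 3)` and factor `k + 3`. The shift by `3` makes `ρ
    -- ≤ 2 / 3`, so the radii are positive on the closed ball and `‖t‖ + ε < 1`.
    have hk : (0 : ℝ) < k + 3 := by positivity
    have hk1 : 1 / ((k : ℝ) + 3) ≤ 1 / 3 := by gcongr; linarith [k.cast_nonneg (α := ℝ)]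
    have hk0 : 0 < 1 / ((k : ℝ) + 3) := by positivity
    refine (frequently_exists_coverRadius_lt h𝒰 heq hf hnn hk0 (by linarith)
      (r := 1 / ((k : ℝ) + 3) / (k + 3)) (by positivity)).mono ?_
    rintro n ⟨z, hz, hzr⟩
    have hpos : ∀ w : ℂ, ‖w‖ ≤ 2 * (1 / ((k : ℝ) + 3)) → 0 < coverRadius 𝒰 (f n) w := fun w hw =>
      coverRadius_pos hop hcov (hf n).continuousOn (by linarith)
    rw [lt_div_iff₀' hk] at hzr
    obtain ⟨t, ht, htR, hw⟩ := exists_forall_le_two_mul (z := z)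
      (continuous_coverRadius h𝒰).continuousOn hpos hk (by linarith) (by linarith)
    exact ⟨t, ht, hpos t ht.le, htR, hw⟩
  obtain ⟨φ, hφ, hsel⟩ := extraction_forall_of_frequently hsel
  choose t ht hpos hle hw using hsel
  have hlim : Tendsto (fun k : ℕ => 2 * (1 / ((k : ℝ) + 3))) atTop (𝓝 0) := by
    have := (tendsto_const_div_atTop_nhds_zero_nat (1 : ℝ)).comp (tendsto_add_atTop_nat 3)
    simpa using this.const_mul 2
  have h3 : ∀ k : ℕ, 3 * coverRadius 𝒰 (f (φ k)) (t k) ≤ 2 * (1 / ((k : ℝ) + 3)) := fun k =>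
    le_trans (by nlinarith [hpos k, k.cast_nonneg (α := ℝ)]) (hle k)
  refine ⟨φ, hφ, t, fun k => coverRadius 𝒰 (f (φ k)) (t k), hpos, fun k => ?_, ?_, ?_,
    fun k => rfl, fun k z hz => hw k _ ?_⟩
  · have hk1 : 1 / ((k : ℝ) + 3) ≤ 1 / 3 := by gcongr; linarith [k.cast_nonneg (α := ℝ)]
    linarith [ht k, h3 k]
  · exact squeeze_zero_norm (fun k => (ht k).le) hlim
  · exact squeeze_zero (fun k => (hpos k).le) (fun k => by linarith [h3 k, hpos k]) hlim
  · rw [dist_eq_norm, add_sub_cancel_left, norm_mul, Complex.norm_real, Real.norm_eq_abs,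
      abs_of_pos (hpos k)]
    nlinarith [hpos k]

end Manifold

/-! ### The limit map -/

/-- `X` is a compact complex manifold of dimension `m`. As `X` is compact and Hausdorff, its
topology comes from exactly one uniform structure, that of any distance defining the topology
(for instance one induced by a hermitian metric). The maps `f n` are only meaningful on the unit
disc; since `t n → 0` and `ε n → 0`, on each compact subset of `ℂ` the map `f n ∘ r n` involves,
for large `n`, only values of `f n` on the unit disc. -/
theorem mainTheorem5 {m : ℕ} {X : Type*} [UniformSpace X] [CompactSpace X] [T2Space X]
    [ChartedSpace (EuclideanSpace ℂ (Fin m)) X]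
    [IsManifold 𝓘(ℂ, EuclideanSpace ℂ (Fin m)) ω X]
    (f : ℕ → ℂ → X)
    (hf : ∀ n, MDifferentiableOn 𝓘(ℂ) 𝓘(ℂ, EuclideanSpace ℂ (Fin m)) (f n) (Metric.ball 0 1))
    (hnn : ¬ SeqNormalAt f (Metric.ball 0 1) 0) :
    ∃ t ε : ℕ → ℂ,
      (∀ n, ε n ≠ 0 ∧ ‖t n‖ + ‖ε n‖ < 1) ∧
      Tendsto t atTop (𝓝 0) ∧ Tendsto ε atTop (𝓝 0) ∧
      ∃ φ : ℕ → ℕ, StrictMono φ ∧ ∃ g : ℂ → X,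
        TendstoLocallyUniformly (fun n z => f (φ n) (t (φ n) + ε (φ n) * z)) g atTop ∧
        MDifferentiable 𝓘(ℂ) 𝓘(ℂ, EuclideanSpace ℂ (Fin m)) g ∧
        UniformContinuous g ∧
        ¬ ∃ c : X, ∀ z : ℂ, g z = c := by
  have := ChartedSpace.isCountablyGenerated_uniformity (EuclideanSpace ℂ (Fin m)) (X := X)
  obtain ⟨𝒰, -, hop, hcov, heq⟩ :=
    exists_finite_cover_forall_mapsTo_ball (E := EuclideanSpace ℂ (Fin m)) (X := X)
  have h𝒰 : 𝒰.Nonempty := (hcov (f 0 0)).imp fun A hA => hA.1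
  obtain ⟨φ, hφ, t, ε, hε, htε, ht0, hε0, hRt, hRw⟩ := exists_rescaling hop hcov heq hf hnn
  have hequi : ∀ V ∈ 𝓤 X, ∃ δ > 0, ∀ (k : ℕ) (z w : ℂ), 2 * ‖z‖ ≤ k → dist w z < δ →
      (f (φ k) (t k + ε k * z), f (φ k) (t k + ε k * w)) ∈ V := by
    intro V hV
    obtain ⟨δ, hδ, hδV⟩ := heq V hV
    -- The radius is at least `ε k / 2`; taking `ε k / 3` gives the strict inequality needed.
    refine ⟨δ / 3, by positivity, fun k z w hz hw => ?_⟩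
    have h1 := hRw k z hz
    have h2 := hε k
    refine mem_entourage_of_lt_coverRadius h𝒰 hδV (hf _) (r := ε k / 3) (by positivity)
      (by linarith) ?_
    rw [dist_add_left, dist_eq_norm, ← mul_sub, norm_mul, Complex.norm_real, Real.norm_eq_abs,
      abs_of_pos h2, ← dist_eq_norm]
    nlinarith
  have hlarge : ∀ r : ℝ, ∀ᶠ k : ℕ in atTop, r ≤ k := fun r =>
    tendsto_natCast_atTop_atTop.eventually_ge_atTop r
  obtain ⟨ψ, hψ, g, hg⟩ := exists_subseq_tendstoLocallyUniformlyOn (U := univ)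
    (fun k z => f (φ k) (t k + ε k * z)) (by
      intro z _ V hV
      obtain ⟨δ, hδ, hδV⟩ := hequi V hV
      refine ⟨ball z δ, ball_mem_nhds z hδ, ?_⟩
      filter_upwards [hlarge (2 * ‖z‖)] with k hk w hw using hδV k z w hk hw)
  rw [tendstoLocallyUniformlyOn_univ] at hg
  have hr : ∀ (k : ℕ) (R : ℝ), MapsTo (fun z : ℂ => t k + ε k * z) (ball 0 R)
      (ball (t k) (ε k * R)) := by
    intro k R z hz
    rw [mem_ball, dist_eq_norm, add_sub_cancel_left, norm_mul, Complex.norm_real,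
      Real.norm_eq_abs, abs_of_pos (hε k)]
    exact mul_lt_mul_of_pos_left (mem_ball_zero_iff.1 hz) (hε k)
  have hsmall : ∀ R : ℝ, ∀ᶠ k in atTop, ‖t k‖ + ε k * R < 1 := fun R => by
    have := ht0.norm.add (hε0.mul_const R)
    rw [norm_zero, zero_mul, add_zero] at this
    exact this.eventually_lt_const one_pos
  -- Off the range of `φ`, center `0` and scale `1 / (n + 2)` suffice; `1 / (n + 1)` would equal `1`
  -- at `n = 0`.
  refine ⟨Function.extend φ t fun _ => 0,
    Function.extend φ (fun k => (ε k : ℂ)) fun n => 1 / ((n : ℂ) + 2), fun n => ?_, ?_, ?_,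
    φ ∘ ψ, hφ.comp hψ, g, ?_, ?_, ?_, ?_⟩
  · by_cases hn : ∃ k, φ k = n
    · obtain ⟨k, rfl⟩ := hn
      rw [hφ.injective.extend_apply, hφ.injective.extend_apply, Complex.norm_real,
        Real.norm_eq_abs, abs_of_pos (hε k)]
      exact ⟨Complex.ofReal_ne_zero.2 (hε k).ne', htε k⟩
    · rw [Function.extend_apply' _ _ _ hn, Function.extend_apply' _ _ _ hn]
      have h2 : (n : ℂ) + 2 = ((n + 2 : ℕ) : ℂ) := by push_cast; rfl
      rw [h2]
      refine ⟨one_div_ne_zero (Nat.cast_ne_zero.2 (by omega)), ?_⟩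
      rw [norm_zero, zero_add, norm_div, norm_one, Complex.norm_natCast,
        div_lt_one (by positivity)]
      push_cast
      linarith [n.cast_nonneg (α := ℝ)]
  · exact tendsto_extend_atTop hφ ht0 tendsto_const_nhds
  · refine tendsto_extend_atTop hφ ?_ ?_
    · simpa [Function.comp_def] using (Complex.continuous_ofReal.tendsto 0).comp hε0
    · simpa [Function.comp_def] using (tendsto_const_div_atTop_nhds_zero_nat (1 : ℂ)).comp
        (tendsto_add_atTop_nat 2)
  · simpa only [Function.comp_apply, hφ.injective.extend_apply] using hg
  · refine mdifferentiable_of_tendstoLocallyUniformly hg fun R => ?_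
    filter_upwards [hψ.tendsto_atTop.eventually (hsmall R)] with n hn
    refine (hf _).comp (g := f (φ (ψ n))) (f := fun z : ℂ => t (ψ n) + ε (ψ n) * z) ?_
      ((hr _ R).mono_right (ball_subset_ball' ?_))
    · exact mdifferentiableOn_iff_differentiableOn.2 (by fun_prop)
    · rw [dist_zero_right]
      linarith
  · intro V hV
    obtain ⟨V', ⟨hV', hcl⟩, hVV'⟩ := uniformity_hasBasis_closed.mem_iff.1 hV
    obtain ⟨δ, hδ, hδV⟩ := hequi V' hV'
    refine mem_map.2 (mem_of_superset (dist_mem_uniformity hδ) ?_)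
    rintro ⟨z, w⟩ hzw
    have hpt := fun z => (hg.tendstoLocallyUniformlyOn (s := univ)).tendsto_at (mem_univ z)
    refine hVV' (hcl.mem_of_tendsto ((hpt z).prodMk_nhds (hpt w)) ?_)
    -- Only the starting index depends on `z`; `δ` does not, so the limit is uniformly continuous.
    filter_upwards [hψ.tendsto_atTop.eventually (hlarge (2 * ‖z‖))] with n hn
    exact hδV _ z w hn (by rwa [dist_comm])
  · rintro ⟨c, hc⟩
    obtain ⟨A, hA, hcA⟩ := hcov c
    obtain ⟨V, hV, hVA⟩ := UniformSpace.mem_nhds_iff.1 ((hop A hA).mem_nhds hcA)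
    have hu := (tendstoLocallyUniformlyOn_iff_tendstoUniformlyOn_of_compact
      (isCompact_closedBall (0 : ℂ) 2)).1 hg.tendstoLocallyUniformlyOn
    obtain ⟨n, hnA, hn1⟩ :=
      ((hu V hV).and (hψ.tendsto_atTop.eventually (hsmall 2))).exists
    -- Any radius above `1` in place of `2` would contradict `hRt`.
    have h2 : ε (ψ n) * 2 ≤ coverRadius 𝒰 (f (φ (ψ n))) (t (ψ n)) := by
      refine le_coverRadius (by linarith) hA fun w hw => ?_
      have hε' := hε (ψ n)
      have hw' : w = t (ψ n) + ε (ψ n) * ((w - t (ψ n)) / ε (ψ n)) := by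
        rw [mul_div_cancel₀ _ (Complex.ofReal_ne_zero.2 hε'.ne')]
        ring
      have hz : (w - t (ψ n)) / ε (ψ n) ∈ closedBall (0 : ℂ) 2 := by
        rw [mem_closedBall_zero_iff, norm_div, Complex.norm_real, Real.norm_eq_abs,
          abs_of_pos hε', div_le_iff₀ hε', ← dist_eq_norm, mul_comm]
        exact (mem_ball.1 hw).le
      have : (g _, f (φ (ψ n)) (t (ψ n) + ε (ψ n) * _)) ∈ V := hnA _ hz
      rw [hc, ← hw'] at this
      exact hVA this
    rw [hRt] at h2
    linarith [hε (ψ n)]
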